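/- Let $n\ge 1$, let $S^{n-1}$ be the unit sphere and $B^n$ the closed unit Euclidean ball of $\mathbb{R}^n$, and let $du$ denote the spherical (surface area) measure on $S^{n-1}$. Let $\mathcal{K}_{(o)}^n$ be the set of compact convex subsets of $\mathbb{R}^n$ containing the origin in their interiors. For $K\in\mathcal{K}_{(o)}^n$ let $h_K(u)=\max_{x\in K}\langle x,u\rangle$ and $\rho_K(u)=\max\{\lambda\ge 0:\lambda u\in K\}$ ($u\in S^{n-1}$) be its support and radial functions, and $K^\circ=\{x\in\mathbb{R}^n:\langle x,y\rangle\le 1\ \forall y\in K\}$ its polar body. Let $\varphi:(0,\infty)\to(0,\infty)$ be continuous and strictly increasing with $\lim_{t\to0^+}\varphi(t)=0$, $\varphi(1)=1$ and $\lim_{t\to\infty}\varphi(t)=\infty$. Let $\mu$ be a nonzero finite Borel measure on $S^{n-1}$ that is not concentrated on any closed hemisphere. Let $G:(0,\infty)\times S^{n-1}\to(0,\infty)$ be continuous and such that, for every $u\in S^{n-1}$, $t\mapsto G(t,u)$ is strictly increasing with $\lim_{t\to0^+}G(t,u)=0$ and $\lim_{t\to\infty}G(t,u)=\infty$; assume moreover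 that for some real $q\ge n-1$ $$\inf\Big\{\frac{G(t,u)}{t^q}:\ t\ge 1,\ u\in S^{n-1}\Big\}>0 .$$ For $K\in\mathcal{K}_{(o)}^n$ put $$\widetilde V_G(K)=\int_{S^{n-1}}G(\rho_K(u),u)\,du,\qquad \widehat V_G(K)=\inf\Big\{\eta>0:\ \int_{S^{n-1}}G\Big(\frac{\rho_K(u)}{\eta},u\Big)du\le 1\Big\},$$ $$\widetilde{\mathcal B}=\{Q\in\mathcal{K}_{(o)}^n:\widetilde V_G(Q^\circ)=\widetilde V_G(B^n)\},\qquad \widehat{\mathcal B}=\{Q\in\mathcal{K}_{(o)}^n:\widehat V_G(Q^\circ)=\widehat V_G(B^n)\}.$$ Then the following statements hold. (i) There exists $\widetilde M\in\widetilde{\mathcal B}$ such that $$\int_{S^{n-1}}\varphi(h_{\widetilde M}(u))\,d\mu(u)=\inf\Big\{\int_{S^{n-1}}\varphi(h_Q(u))\,d\mu(u):\ Q\in\widetilde{\mathcal B}\Big\}.$$ If, in addition, $\varphi$ is convex and $G(\cdot,u)$ is convex on $(0,\infty)$ for every $u\in S^{n-1}$, then such an $\widetilde M$ is unique. (ii)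 There exists $\widehat M\in\widehat{\mathcal B}$ such that $$\int_{S^{n-1}}\varphi(h_{\widehat M}(u))\,d\mu(u)=\inf\Big\{\int_{S^{n-1}}\varphi(h_Q(u))\,d\mu(u):\ Q\in\widehat{\mathcal B}\Big\}.$$ If, in addition, $\varphi$ is convex and $G(\cdot,u)$ is convex on $(0,\infty)$ for every $u\in S^{n-1}$, then such an $\widehat M$ is unique. -/

import Mathlib

open MeasureTheory Set Filter Topology

noncomputable section

namespace DualPolarOrlicz

/-- Euclidean `n`-space. -/
abbrev E (n : ℕ) : Type := EuclideanSpace ℝ (Fin n)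

/-- The unit sphere of `ℝⁿ`, with its Borel σ-algebra. -/
abbrev Sph (n : ℕ) : Type := Metric.sphere (0 : E n) 1

/-- The unit Euclidean ball of `ℝⁿ`. -/
def unitBall (n : ℕ) : Set (E n) := Metric.closedBall 0 1

/-- The spherical (surface area) measure on the unit sphere. -/
def sphMeasure (n : ℕ) : Measure (Sph n) := (volume : Measure (E n)).toSphere

variable {n : ℕ}

/-- Support function `h_K(u) = max {⟨x, u⟩ : x ∈ K}`. -/
def supportFun (K : Set (E n)) (u : Sph n) : ℝ :=
  sSup ((fun x : E n => inner ℝ x (u : E n)) '' K)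

/-- Radial function `ρ_K(u) = max {r ≥ 0 : r u ∈ K}`. -/
def radialFun (K : Set (E n)) (u : Sph n) : ℝ :=
  sSup {r : ℝ | 0 ≤ r ∧ r • (u : E n) ∈ K}

/-- Polar body `K° = {x : ⟨x, y⟩ ≤ 1 for all y ∈ K}`. -/
def polarBody (K : Set (E n)) : Set (E n) :=
  {x | ∀ y ∈ K, inner ℝ x y ≤ (1 : ℝ)}

/-- Convex bodies with the origin in their interior. -/
def bodiesO (n : ℕ) : Set (ConvexBody (E n)) :=
  {K | (0 : E n) ∈ interior (K : Set (E n))}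

/-- General dual volume `∫ G(ρ_K(u), u) du`. -/
def dualVol (G : ℝ → Sph n → ℝ) (K : Set (E n)) : ℝ :=
  ∫ u, G (radialFun K u) u ∂(sphMeasure n)

/-- Homogeneous general dual volume for `G` increasing in its first variable:
`inf {η > 0 : ∫ G(ρ_K(u)/η, u) du ≤ 1}`. -/
def homDualVol (G : ℝ → Sph n → ℝ) (K : Set (E n)) : ℝ :=
  sInf {η : ℝ | 0 < η ∧ ∫ u, G (radialFun K u / η) u ∂(sphMeasure n) ≤ 1}

/-- Functions `φ : (0,∞) → (0,∞)` that are continuous and strictly increasing, with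
`φ(0+) = 0`, `φ(1) = 1`, `φ(∞) = ∞`. Values outside `(0,∞)` are irrelevant. -/
structure ClassI (φ : ℝ → ℝ) : Prop where
  pos : ∀ t, 0 < t → 0 < φ t
  continuousOn : ContinuousOn φ (Ioi 0)
  strictMonoOn : StrictMonoOn φ (Ioi 0)
  tendsto_zero : Tendsto φ (𝓝[>] 0) (𝓝 0)
  map_one : φ 1 = 1
  tendsto_top : Tendsto φ atTop atTop

/-- Functions `G : (0,∞) × S^{n-1} → (0,∞)` that are (jointly) continuous and, for every fixed
`u`, strictly increasing in `t` with limits `0` at `0+` and `∞` at `∞`.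
Values at `t ≤ 0` are irrelevant. -/
structure ClassGI (G : ℝ → Sph n → ℝ) : Prop where
  pos : ∀ t u, 0 < t → 0 < G t u
  continuousOn : ContinuousOn (fun p : ℝ × Sph n => G p.1 p.2) (Ioi 0 ×ˢ univ)
  strictMonoOn : ∀ u, StrictMonoOn (fun t => G t u) (Ioi 0)
  tendsto_zero : ∀ u, Tendsto (fun t => G t u) (𝓝[>] 0) (𝓝 0)
  tendsto_top : ∀ u, Tendsto (fun t => G t u) atTop atTop

/-- `inf {G(t,u) / t^q : t ≥ 1, u ∈ S^{n-1}} > 0`. -/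
def GrowthCond (G : ℝ → Sph n → ℝ) (q : ℝ) : Prop :=
  0 < sInf ((fun p : ℝ × Sph n => G p.1 p.2 / p.1 ^ q) '' (Ici 1 ×ˢ univ))

/-- `μ` is concentrated on some closed hemisphere `{u : ⟨u, v⟩ ≥ 0}`, `v ∈ S^{n-1}`. -/
def ConcentratedOnHemisphere (μ : Measure (Sph n)) : Prop :=
  ∃ v : Sph n, μ {u : Sph n | 0 ≤ (inner ℝ (u : E n) (v : E n) : ℝ)}ᶜ = 0

/-- The bodies `Q` whose polar body has the same general dual volume as the unit ball. -/
def tildeB (G : ℝ → Sph n → ℝ) : Set (ConvexBody (E n)) :=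
  {Q | Q ∈ bodiesO n ∧ dualVol G (polarBody (Q : Set (E n))) = dualVol G (unitBall n)}

/-- The bodies `Q` whose polar body has the same homogeneous general dual volume as the
unit ball. -/
def hatB (G : ℝ → Sph n → ℝ) : Set (ConvexBody (E n)) :=
  {Q | Q ∈ bodiesO n ∧ homDualVol G (polarBody (Q : Set (E n))) = homDualVol G (unitBall n)}

/-- The objective `∫ φ(h_Q(u)) dμ(u)`. -/
def objective (φ : ℝ → ℝ) (μ : Measure (Sph n)) (Q : ConvexBody (E n)) : ℝ :=
  ∫ u, φ (supportFun (Q : Set (E n)) u) ∂μ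

/-- `M ∈ B` and `∫ φ(h_M) dμ = inf {∫ φ(h_Q) dμ : Q ∈ B}`. -/
def IsSolution (φ : ℝ → ℝ) (μ : Measure (Sph n)) (B : Set (ConvexBody (E n)))
    (M : ConvexBody (E n)) : Prop :=
  M ∈ B ∧ objective φ μ M = sInf (objective φ μ '' B)

end DualPolarOrlicz

end

/-! Existence is the direct method. Since `μ` charges all open hemispheres uniformly and `φ` tends
to infinity, bodies with bounded objective are uniformly bounded (`exists_norm_le_of_objective_le`).
Blaschke selection then extracts a limit `L` of a minimizing sequence `Q i`. Once `h_L > 0`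
everywhere, dominated convergence carries both the constraint and the objective to `L`.

The crux is this positivity (`supportFun_pos_of_tendsto`). If `h_L u = 0`, then `h_L v ≤ R * dist v
u`, so `F = liminf G(1 / h_{Q i})` is at least of order `dist v u ^ (-(n - 1))` near `u`, while
Fatou makes `F` integrable. A cap of radius `r` has measure at least of order `r ^ (n - 1)`, so the
`F`-mass of small caps at `u` stays bounded below. Shrinking the caps leaves an atom at `u`, hence
the point `u` itself has positive surface measure. As `F u = ⊤`, the integral of `F` is infinite, a
contradiction. This covers the borderline exponent `n - 1`, and also `n = 1`, where points do have
mass.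

For uniqueness, take the Minkowski midpoint of two distinct minimizers. Strict convexity of `1 / t`
and convexity of `G` make its polar volume strictly too small, so it can be shrunk back onto the
constraint. Convexity of `φ` then gives an objective strictly below the minimum.

Statement (ii) is (i) for `G (η * t) u` with a suitable `η`, see `ClassGI.exists_hatB_eq_tildeB`. -/

namespace DualPolarOrlicz

variable {n : ℕ}

/-! ### Support functions, polarity and Blaschke selection -/

section Support

open Metric Pointwise TopologicalSpace

theorem norm_sph (u : Sph n) : ‖(u : E n)‖ = 1 := by
  simp

theorem bddAbove_inner_image {K : Set (E n)} (hK : IsCompact K) (u : Sph n) :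
    BddAbove ((fun x : E n => inner ℝ x (u : E n)) '' K) :=
  (hK.image (by fun_prop)).bddAbove

theorem inner_le_supportFun {K : Set (E n)} (hK : IsCompact K) {x : E n} (hx : x ∈ K)
    (u : Sph n) : inner ℝ x (u : E n) ≤ supportFun K u :=
  le_csSup (bddAbove_inner_image hK u) (mem_image_of_mem _ hx)

theorem exists_inner_eq_supportFun {K : Set (E n)} (hK : IsCompact K) (hne : K.Nonempty)
    (u : Sph n) : ∃ x ∈ K, inner ℝ x (u : E n) = supportFun K u := by
  obtain ⟨x, hx, h⟩ := (hK.image (f := fun x : E n => inner ℝ x (u : E n))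
    (by fun_prop)).sSup_mem (hne.image _)
  exact ⟨x, hx, h⟩

theorem supportFun_eq_of {K : Set (E n)} (hK : IsCompact K) {u : Sph n} {c : ℝ}
    (h1 : ∃ x ∈ K, inner ℝ x (u : E n) = c) (h2 : ∀ x ∈ K, inner ℝ x (u : E n) ≤ c) :
    supportFun K u = c := by
  obtain ⟨x, hx, hxc⟩ := h1
  obtain ⟨y, hy, hyc⟩ := exists_inner_eq_supportFun hK ⟨x, hx⟩ u
  refine le_antisymm (hyc ▸ h2 y hy) (hxc ▸ inner_le_supportFun hK hx u)

theorem supportFun_le_add_hausdorffDist (K L : NonemptyCompacts (E n)) (u : Sph n) :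
    supportFun (K : Set (E n)) u ≤ supportFun (L : Set (E n)) u + dist K L := by
  obtain ⟨x, hx, hxu⟩ := exists_inner_eq_supportFun K.isCompact K.nonempty u
  obtain ⟨y, hy, hxy⟩ := L.isCompact.exists_infDist_eq_dist L.nonempty x
  have h1 : dist x y ≤ dist K L := by
    rw [← hxy, NonemptyCompacts.dist_eq]
    exact infDist_le_hausdorffDist_of_mem hx (hausdorffEDist_ne_top_of_nonempty_of_bounded
      K.nonempty L.nonempty K.isCompact.isBounded L.isCompact.isBounded)
  have h2 : inner ℝ (x - y) (u : E n) ≤ dist x y := by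
    have := real_inner_le_norm (x - y) (u : E n)
    rwa [norm_sph, mul_one, ← dist_eq_norm] at this
  rw [inner_sub_left] at h2
  linarith [inner_le_supportFun L.isCompact hy u]

theorem tendstoUniformly_supportFun {K : ℕ → NonemptyCompacts (E n)} {L : NonemptyCompacts (E n)}
    (h : Tendsto K atTop (𝓝 L)) :
    TendstoUniformly (fun i => supportFun (K i : Set (E n))) (supportFun (L : Set (E n))) atTop := by
  rw [Metric.tendstoUniformly_iff]
  intro ε hε
  filter_upwards [Metric.tendsto_nhds.1 h ε hε] with i hi u
  have h1 := supportFun_le_add_hausdorffDist (K i) L u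
  have h2 := supportFun_le_add_hausdorffDist L (K i) u
  rw [dist_comm L] at h2
  rw [Real.dist_eq, abs_lt]
  constructor <;> linarith

theorem supportFun_le_add {K : Set (E n)} (hK : IsCompact K) (hne : K.Nonempty) {R : ℝ}
    (hR : ∀ x ∈ K, ‖x‖ ≤ R) (u v : Sph n) :
    supportFun K u ≤ supportFun K v + R * dist u v := by
  obtain ⟨x, hx, hxu⟩ := exists_inner_eq_supportFun hK hne u
  have h1 := inner_le_supportFun hK hx v
  have h2 : inner ℝ x ((u : E n) - v) ≤ ‖x‖ * dist u v := by
    rw [Subtype.dist_eq, dist_eq_norm]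
    exact real_inner_le_norm _ _
  rw [inner_sub_right] at h2
  have h3 := mul_le_mul_of_nonneg_right (hR x hx) (dist_nonneg (x := u) (y := v))
  linarith

theorem continuous_supportFun {K : Set (E n)} (hK : IsCompact K) (hne : K.Nonempty) :
    Continuous (supportFun K) := by
  obtain ⟨R, hR⟩ := hK.isBounded.exists_norm_le
  have hR0 : 0 ≤ R := (norm_nonneg _).trans (hR _ hne.some_mem)
  exact (LipschitzWith.of_le_add_mul (K := ⟨R, hR0⟩)
    fun u v => supportFun_le_add hK hne hR u v).continuous

theorem supportFun_le {K : Set (E n)} (hK : IsCompact K) (hne : K.Nonempty) {R : ℝ}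
    (hR : ∀ x ∈ K, ‖x‖ ≤ R) (u : Sph n) : supportFun K u ≤ R := by
  obtain ⟨x, hx, hxu⟩ := exists_inner_eq_supportFun hK hne u
  rw [← hxu]
  refine (real_inner_le_norm _ _).trans ?_
  rw [norm_sph, mul_one]
  exact hR x hx

theorem supportFun_add (K L : ConvexBody (E n)) (u : Sph n) :
    supportFun ((K + L : ConvexBody (E n)) : Set (E n)) u
      = supportFun (K : Set (E n)) u + supportFun (L : Set (E n)) u := by
  obtain ⟨x, hx, hxu⟩ := exists_inner_eq_supportFun K.isCompact K.nonempty u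
  obtain ⟨y, hy, hyu⟩ := exists_inner_eq_supportFun L.isCompact L.nonempty u
  refine supportFun_eq_of (K + L).isCompact ?_ ?_
  · exact ⟨x + y, by rw [ConvexBody.coe_add]; exact Set.add_mem_add hx hy,
      by rw [inner_add_left, hxu, hyu]⟩
  · rw [ConvexBody.coe_add]
    rintro _ ⟨a, ha, b, hb, rfl⟩
    simp only [inner_add_left]
    exact add_le_add (inner_le_supportFun K.isCompact ha u) (inner_le_supportFun L.isCompact hb u)

theorem supportFun_smul (K : ConvexBody (E n)) {c : ℝ} (hc : 0 ≤ c) (u : Sph n) :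
    supportFun ((c • K : ConvexBody (E n)) : Set (E n)) u = c * supportFun (K : Set (E n)) u := by
  obtain ⟨x, hx, hxu⟩ := exists_inner_eq_supportFun K.isCompact K.nonempty u
  refine supportFun_eq_of (c • K).isCompact ?_ ?_
  · exact ⟨c • x, by rw [ConvexBody.coe_smul]; exact Set.smul_mem_smul_set hx,
      by rw [real_inner_smul_left, hxu]⟩
  · rw [ConvexBody.coe_smul]
    rintro _ ⟨a, ha, rfl⟩
    simp only [real_inner_smul_left]
    exact mul_le_mul_of_nonneg_left (inner_le_supportFun K.isCompact ha u) hc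

theorem supportFun_closedBall {r : ℝ} (hr : 0 ≤ r) (u : Sph n) :
    supportFun (closedBall (0 : E n) r) u = r := by
  refine supportFun_eq_of (isCompact_closedBall _ _) ⟨r • (u : E n), ?_, ?_⟩ fun x hx => ?_
  · simp [norm_smul, abs_of_nonneg hr]
  · rw [real_inner_smul_left, real_inner_self_eq_norm_sq, norm_sph]; simp
  · refine (real_inner_le_norm _ _).trans ?_
    rw [norm_sph, mul_one]
    simpa using hx

theorem radialFun_polarBody {K : Set (E n)} (hK : IsCompact K) {u : Sph n}
    (hu : 0 < supportFun K u) (hne : K.Nonempty) :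
    radialFun (polarBody K) u = 1 / supportFun K u := by
  have : {r : ℝ | 0 ≤ r ∧ r • (u : E n) ∈ polarBody K} = Icc 0 (1 / supportFun K u) := by
    ext r
    simp only [mem_ofPred_eq, mem_Icc, polarBody, real_inner_smul_left, and_congr_right_iff]
    intro hr
    rw [le_div_iff₀ hu]
    constructor
    · intro h
      obtain ⟨x, hx, hxu⟩ := exists_inner_eq_supportFun hK hne u
      rw [← hxu, real_inner_comm]
      exact h x hx
    · intro h y hy
      rw [real_inner_comm]
      exact (mul_le_mul_of_nonneg_left (inner_le_supportFun hK hy u) hr).trans h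
  rw [radialFun, this, csSup_Icc (by positivity)]

theorem radialFun_unitBall (u : Sph n) : radialFun (unitBall n) u = 1 := by
  have : {r : ℝ | 0 ≤ r ∧ r • (u : E n) ∈ unitBall n} = Icc 0 1 := by
    ext r
    simp only [mem_ofPred_eq, mem_Icc, unitBall, mem_closedBall_zero_iff, norm_smul, norm_sph,
      mul_one, Real.norm_eq_abs, and_congr_right_iff]
    intro hr
    rw [abs_of_nonneg hr]
  rw [radialFun, this, csSup_Icc zero_le_one]

/-- A point outside a convex body is separated from it by a unit direction. -/
theorem exists_supportFun_lt_inner (K : ConvexBody (E n)) {x : E n} (hx : x ∉ K) :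
    ∃ u : Sph n, supportFun (K : Set (E n)) u < inner ℝ x (u : E n) := by
  obtain ⟨f, s, hf, hs⟩ := geometric_hahn_banach_closed_point K.convex K.isClosed hx
  set w : E n := (InnerProductSpace.toDual ℝ (E n)).symm f
  have hw : ∀ y, f y = inner ℝ y w := fun y => by
    rw [real_inner_comm]; simp [w]
  have hw0 : w ≠ 0 := by
    rintro h0
    obtain ⟨y, hy⟩ := K.nonempty
    have := (hf y hy).trans hs
    simp [hw, h0] at this
  have hpos : 0 < ‖w‖ := norm_pos_iff.2 hw0
  refine ⟨⟨‖w‖⁻¹ • w, by simp [norm_smul, hpos.ne']⟩, ?_⟩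
  obtain ⟨y, hy, hyu⟩ := exists_inner_eq_supportFun K.isCompact K.nonempty
    (⟨‖w‖⁻¹ • w, by simp [norm_smul, hpos.ne']⟩ : Sph n)
  rw [← hyu]
  simp only [real_inner_smul_right, ← hw]
  exact mul_lt_mul_of_pos_left ((hf y hy).trans hs) (inv_pos.2 hpos)

theorem convexBody_ext_supportFun {K L : ConvexBody (E n)}
    (h : ∀ u, supportFun (K : Set (E n)) u = supportFun (L : Set (E n)) u) : K = L := by
  refine ConvexBody.ext (Set.Subset.antisymm (fun x hx => ?_) (fun x hx => ?_))
  · by_contra hx'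
    obtain ⟨u, hu⟩ := exists_supportFun_lt_inner L hx'
    linarith [inner_le_supportFun K.isCompact hx u, h u]
  · by_contra hx'
    obtain ⟨u, hu⟩ := exists_supportFun_lt_inner K hx'
    linarith [inner_le_supportFun L.isCompact hx u, h u]

theorem supportFun_pos {K : ConvexBody (E n)} (hK : K ∈ bodiesO n) (u : Sph n) :
    0 < supportFun (K : Set (E n)) u := by
  obtain ⟨r, hr, hrK⟩ := Metric.nhds_basis_closedBall.mem_iff.1 (mem_interior_iff_mem_nhds.1 hK)
  have h1 : r • (u : E n) ∈ (K : Set (E n)) :=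
    hrK (by simp [norm_smul, abs_of_pos hr])
  have h2 := inner_le_supportFun K.isCompact h1 u
  rw [real_inner_smul_left, real_inner_self_eq_norm_sq, norm_sph] at h2
  linarith

/-- By compactness the support function attains a positive minimum on the sphere; separation shows
that the open ball of that radius lies in `K`. -/
theorem mem_bodiesO_of_supportFun_pos [Nonempty (Sph n)] {K : ConvexBody (E n)}
    (hK : ∀ u, 0 < supportFun (K : Set (E n)) u) : K ∈ bodiesO n := by
  obtain ⟨u, -, hu⟩ := isCompact_univ.exists_isMinOn (univ_nonempty (α := Sph n))
    (continuous_supportFun K.isCompact K.nonempty).continuousOn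
  refine mem_interior_iff_mem_nhds.2 (Filter.mem_of_superset (ball_mem_nhds _ (hK u)) ?_)
  intro x hx
  by_contra hx'
  obtain ⟨v, hv⟩ := exists_supportFun_lt_inner K hx'
  have h1 := real_inner_le_norm x (v : E n)
  rw [norm_sph, mul_one] at h1
  have h2 : supportFun (K : Set (E n)) u ≤ supportFun (K : Set (E n)) v := hu (mem_univ v)
  rw [mem_ball_zero_iff] at hx
  linarith

theorem mem_bodiesO_iff [Nonempty (Sph n)] {K : ConvexBody (E n)} :
    K ∈ bodiesO n ↔ ∀ u, 0 < supportFun (K : Set (E n)) u :=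
  ⟨supportFun_pos, mem_bodiesO_of_supportFun_pos⟩

/-- Blaschke's selection theorem, with convergence expressed as uniform
convergence of support functions. -/
theorem exists_subseq_tendsto_supportFun (Q : ℕ → ConvexBody (E n)) {R : ℝ}
    (hR : ∀ i, ∀ x ∈ Q i, ‖x‖ ≤ R) :
    ∃ (L : ConvexBody (E n)) (s : ℕ → ℕ), StrictMono s ∧ (∀ x ∈ L, ‖x‖ ≤ R) ∧
      TendstoUniformly (fun i => supportFun (Q (s i) : Set (E n))) (supportFun (L : Set (E n)))
        atTop := by
  obtain ⟨K, hK⟩ : ∃ K : ℕ → NonemptyCompacts (E n), ∀ i, (K i : Set (E n)) = Q i :=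
    ⟨fun i => ⟨⟨Q i, (Q i).isCompact⟩, (Q i).nonempty⟩, fun _ => rfl⟩
  obtain ⟨L, hL, s, hs, hlim⟩ := (NonemptyCompacts.isCompact_subsets_of_isCompact
    (isCompact_closedBall (0 : E n) R)).tendsto_subseq (x := K)
    (fun i x hx => mem_closedBall_zero_iff.2 (hR i x ((hK i).subset hx)))
  have hinf : ∀ x : E n, Tendsto (fun i => infDist x (Q (s i) : Set (E n))) atTop
      (𝓝 (infDist x (L : Set (E n)))) := fun x => by
    simpa only [Function.comp_def, hK] using
      ((lipschitz_infDist_set x).continuous.tendsto L).comp hlim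
  -- Distances to the convex sets `Q (s i)` are convex functions, by combining nearest points, and
  -- they converge pointwise to the distance to `L`.
  have hconv : Convex ℝ (L : Set (E n)) := by
    intro x hx y hy a b ha hb hab
    rw [L.isCompact.isClosed.mem_iff_infDist_zero L.nonempty]
    refine le_antisymm ?_ infDist_nonneg
    have h1 := ((hinf x).const_mul a).add ((hinf y).const_mul b)
    rw [infDist_zero_of_mem hx, infDist_zero_of_mem hy] at h1
    simp only [mul_zero, add_zero] at h1
    refine le_of_tendsto_of_tendsto' (hinf _) h1 fun i => ?_
    obtain ⟨x', hx', hxx'⟩ := (Q (s i)).isCompact.exists_infDist_eq_dist (Q (s i)).nonempty x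
    obtain ⟨y', hy', hyy'⟩ := (Q (s i)).isCompact.exists_infDist_eq_dist (Q (s i)).nonempty y
    refine (infDist_le_dist_of_mem ((Q (s i)).convex hx' hy' ha hb hab)).trans ?_
    refine (dist_add_add_le _ _ _ _).trans ?_
    rw [dist_smul₀, dist_smul₀, hxx', hyy', Real.norm_of_nonneg ha, Real.norm_of_nonneg hb]
  refine ⟨⟨L, hconv, L.isCompact, L.nonempty⟩, s, hs,
    fun x hx => mem_closedBall_zero_iff.1 (hL hx), ?_⟩
  have := tendstoUniformly_supportFun hlim
  simp only [Function.comp_def, hK] at this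
  exact this

end Support

/-! ### Integrals of `G` along positive continuous functions -/

section Integral

variable {G : ℝ → Sph n → ℝ}

theorem integrable_of_continuous (ν : Measure (Sph n)) [IsFiniteMeasure ν] {f : Sph n → ℝ}
    (hf : Continuous f) : Integrable f ν :=
  hf.integrable_of_hasCompactSupport (HasCompactSupport.of_compactSpace f)

theorem exists_forall_le_of_continuous {f : Sph n → ℝ} (hf : Continuous f) :
    ∃ b, 0 < b ∧ ∀ u, f u ≤ b := by
  obtain ⟨b, hb⟩ := (isCompact_range hf).bddAbove
  exact ⟨max b 1, by positivity, fun u => (hb (mem_range_self u)).trans (le_max_left _ _)⟩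

theorem integral_lt_integral_of_continuous (ν : Measure (Sph n)) [IsFiniteMeasure ν]
    {f g : Sph n → ℝ} (hf : Continuous f) (hg : Continuous g) (hle : ∀ u, f u ≤ g u)
    (hlt : ν {u | f u < g u} ≠ 0) : ∫ u, f u ∂ν < ∫ u, g u ∂ν := by
  have h : 0 < ∫ u, (g u - f u) ∂ν := by
    rw [integral_pos_iff_support_of_nonneg (fun u => sub_nonneg.2 (hle u))
      (integrable_of_continuous ν (hg.sub hf)), pos_iff_ne_zero]
    refine fun h0 => hlt (measure_mono_null (fun u hu => ?_) h0)
    exact (sub_pos.2 hu).ne'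
  rw [integral_sub (integrable_of_continuous ν hg) (integrable_of_continuous ν hf)] at h
  linarith

theorem ClassGI.continuousAt (hG : ClassGI G) {t : ℝ} (ht : 0 < t) (u : Sph n) :
    ContinuousAt (fun s => G s u) t := by
  have h1 : ContinuousAt (fun p : ℝ × Sph n => G p.1 p.2) (t, u) :=
    hG.continuousOn.continuousAt (prod_mem_nhds (Ioi_mem_nhds ht) univ_mem)
  exact h1.comp (f := fun s : ℝ => (s, u)) (by fun_prop)

theorem ClassGI.continuous_comp (hG : ClassGI G) {f : Sph n → ℝ} (hf : Continuous f)
    (hpos : ∀ u, 0 < f u) : Continuous fun u => G (f u) u :=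
  hG.continuousOn.comp_continuous (hf.prodMk continuous_id) fun u => ⟨hpos u, mem_univ _⟩

theorem ClassGI.mono (hG : ClassGI G) {s t : ℝ} (hs : 0 < s) (hst : s ≤ t) (u : Sph n) :
    G s u ≤ G t u :=
  (hG.strictMonoOn u).monotoneOn hs (hs.trans_le hst) hst

theorem ClassGI.integral_lt (hG : ClassGI G) (ν : Measure (Sph n)) [IsFiniteMeasure ν]
    (hν : ν ≠ 0) {f g : Sph n → ℝ} (hf : Continuous f) (hg : Continuous g) (hpos : ∀ u, 0 < f u)
    (hlt : ∀ u, f u < g u) : ∫ u, G (f u) u ∂ν < ∫ u, G (g u) u ∂ν := by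
  refine integral_lt_integral_of_continuous ν (hG.continuous_comp hf hpos)
    (hG.continuous_comp hg fun u => (hpos u).trans (hlt u))
    (fun u => hG.mono (hpos u) (hlt u).le u) ?_
  have : {u | G (f u) u < G (g u) u} = univ :=
    eq_univ_of_forall fun u => hG.strictMonoOn u (hpos u) ((hpos u).trans (hlt u)) (hlt u)
  rw [this]
  exact fun h => hν (Measure.measure_univ_eq_zero.1 h)

/-- Monotonicity makes `G b u` a dominating function. The limit `g` is kept general to allow the
limit `0` as the argument tends to `0`, where `G` is not controlled. -/
theorem ClassGI.tendsto_integral_of_bounded (hG : ClassGI G) (ν : Measure (Sph n))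
    [IsFiniteMeasure ν] {ι : Type*} {l : Filter ι} [l.IsCountablyGenerated]
    {F : ι → Sph n → ℝ} {g : Sph n → ℝ} {b : ℝ} (hb : 0 < b)
    (hF : ∀ᶠ i in l, Continuous (F i) ∧ ∀ u, 0 < F i u ∧ F i u ≤ b)
    (hlim : ∀ u, Tendsto (fun i => G (F i u) u) l (𝓝 (g u))) :
    Tendsto (fun i => ∫ u, G (F i u) u ∂ν) l (𝓝 (∫ u, g u ∂ν)) := by
  refine tendsto_integral_filter_of_dominated_convergence (fun u => G b u) ?_ ?_
    (integrable_of_continuous ν (hG.continuous_comp continuous_const fun _ => hb))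
    (ae_of_all _ hlim)
  · filter_upwards [hF] with i hi
    exact (hG.continuous_comp hi.1 fun u => (hi.2 u).1).aestronglyMeasurable
  · filter_upwards [hF] with i hi
    refine ae_of_all _ fun u => ?_
    rw [Real.norm_of_nonneg (hG.pos _ u (hi.2 u).1).le]
    exact hG.mono (hi.2 u).1 (hi.2 u).2 u

theorem ClassGI.tendsto_integral (hG : ClassGI G) (ν : Measure (Sph n))
    [IsFiniteMeasure ν] {ι : Type*} {l : Filter ι} [l.IsCountablyGenerated]
    {F : ι → Sph n → ℝ} {f : Sph n → ℝ} {b : ℝ} (hb : 0 < b)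
    (hF : ∀ᶠ i in l, Continuous (F i) ∧ ∀ u, 0 < F i u ∧ F i u ≤ b)
    (hf : ∀ u, 0 < f u) (hlim : ∀ u, Tendsto (fun i => F i u) l (𝓝 (f u))) :
    Tendsto (fun i => ∫ u, G (F i u) u ∂ν) l (𝓝 (∫ u, G (f u) u ∂ν)) :=
  hG.tendsto_integral_of_bounded ν hb hF fun u => (hG.continuousAt (hf u) u).tendsto.comp (hlim u)

theorem ClassGI.continuousOn_integral_mul (hG : ClassGI G) (ν : Measure (Sph n))
    [IsFiniteMeasure ν] {f : Sph n → ℝ} (hf : Continuous f) (hpos : ∀ u, 0 < f u) :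
    ContinuousOn (fun η => ∫ u, G (η * f u) u ∂ν) (Ioi 0) := by
  obtain ⟨b, hb, hfb⟩ := exists_forall_le_of_continuous hf
  intro η (hη : 0 < η)
  refine ContinuousAt.continuousWithinAt ?_
  refine hG.tendsto_integral ν (b := (η + 1) * b) (by positivity) ?_
    (fun u => mul_pos hη (hpos u)) fun u => tendsto_id.mul_const _
  filter_upwards [Ioo_mem_nhds hη (lt_add_one η)] with s hs
  exact ⟨by fun_prop, fun u => ⟨mul_pos hs.1 (hpos u),
    mul_le_mul hs.2.le (hfb u) (hpos u).le (by positivity)⟩⟩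

theorem ClassGI.tendsto_integral_mul_zero (hG : ClassGI G) (ν : Measure (Sph n))
    [IsFiniteMeasure ν] {f : Sph n → ℝ} (hf : Continuous f) (hpos : ∀ u, 0 < f u) :
    Tendsto (fun η => ∫ u, G (η * f u) u ∂ν) (𝓝[>] 0) (𝓝 0) := by
  obtain ⟨b, hb, hfb⟩ := exists_forall_le_of_continuous hf
  have h := hG.tendsto_integral_of_bounded ν (l := 𝓝[>] (0 : ℝ)) (F := fun η u => η * f u)
    (g := fun _ => 0) hb ?_ fun u => ?_
  · simpa using h
  · filter_upwards [Ioo_mem_nhdsGT (zero_lt_one' ℝ)] with s hs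
    exact ⟨by fun_prop, fun u => ⟨mul_pos hs.1 (hpos u),
      (mul_le_of_le_one_left (hpos u).le hs.2.le).trans (hfb u)⟩⟩
  · refine (hG.tendsto_zero u).comp (tendsto_nhdsWithin_iff.2 ⟨?_, ?_⟩)
    · have : Tendsto (fun η : ℝ => η * f u) (𝓝 0) (𝓝 (0 * f u)) := tendsto_id.mul_const _
      rw [zero_mul] at this
      exact this.mono_left nhdsWithin_le_nhds
    · filter_upwards [self_mem_nhdsWithin] with s hs
      exact mul_pos hs (hpos u)

/-- Fatou's lemma for nonnegative continuous functions with bounded integrals. -/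
theorem lintegral_liminf_le_of_integral_le (ν : Measure (Sph n)) [IsFiniteMeasure ν]
    {F : ℕ → Sph n → ℝ} {c : ℝ} (hF : ∀ i, Continuous (F i)) (h0 : ∀ i u, 0 ≤ F i u)
    (hc : ∀ i, ∫ u, F i u ∂ν ≤ c) :
    ∫⁻ u, liminf (fun i => ENNReal.ofReal (F i u)) atTop ∂ν ≤ ENNReal.ofReal c := by
  refine (lintegral_liminf_le fun i => (hF i).measurable.ennreal_ofReal).trans ?_
  refine liminf_le_of_le (by isBoundedDefault) fun a ha => ?_
  obtain ⟨i, hi⟩ := ha.exists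
  refine hi.trans ?_
  rw [← ofReal_integral_eq_lintegral_ofReal (integrable_of_continuous ν (hF i))
    (ae_of_all _ (h0 i))]
  exact ENNReal.ofReal_le_ofReal (hc i)

theorem liminf_ofReal_eq_top {x : ℕ → ℝ} (h : Tendsto x atTop atTop) :
    liminf (fun i => ENNReal.ofReal (x i)) atTop = ⊤ :=
  (ENNReal.tendsto_ofReal_atTop.comp h).liminf_eq

/-- Otherwise Fatou along `η = i + 1` would bound the integral of the constant `⊤` against a nonzero
measure. -/
theorem ClassGI.exists_lt_integral_mul (hG : ClassGI G) (ν : Measure (Sph n))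
    [IsFiniteMeasure ν] (hν : ν ≠ 0) {f : Sph n → ℝ} (hf : Continuous f) (hpos : ∀ u, 0 < f u)
    (c : ℝ) : ∃ η, 0 < η ∧ c < ∫ u, G (η * f u) u ∂ν := by
  by_contra! hcon
  have hp : ∀ i : ℕ, (0 : ℝ) < i + 1 := fun i => by positivity
  have h := lintegral_liminf_le_of_integral_le ν (F := fun i u => G (((i : ℝ) + 1) * f u) u)
    (fun i => hG.continuous_comp (by fun_prop) fun u => mul_pos (hp i) (hpos u))
    (fun i u => (hG.pos _ u (mul_pos (hp i) (hpos u))).le) (fun i => hcon _ (hp i))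
  have htop : ∀ u, liminf (fun i : ℕ => ENNReal.ofReal (G (((i : ℝ) + 1) * f u) u)) atTop = ⊤ :=
    fun u => liminf_ofReal_eq_top ((hG.tendsto_top u).comp
      ((tendsto_atTop_add_const_right _ _ tendsto_natCast_atTop_atTop).atTop_mul_const (hpos u)))
  simp only [htop, lintegral_const] at h
  rw [ENNReal.top_mul fun h => hν (Measure.measure_univ_eq_zero.1 h)] at h
  exact absurd h (by simp)

theorem ClassGI.exists_integral_mul_eq (hG : ClassGI G) (ν : Measure (Sph n))
    [IsFiniteMeasure ν] (hν : ν ≠ 0) {f : Sph n → ℝ} (hf : Continuous f) (hpos : ∀ u, 0 < f u)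
    {c : ℝ} (hc : 0 < c) : ∃ η, 0 < η ∧ ∫ u, G (η * f u) u ∂ν = c := by
  obtain ⟨b, hb, hbc⟩ := hG.exists_lt_integral_mul ν hν hf hpos c
  obtain ⟨a, hac, ha⟩ := (((hG.tendsto_integral_mul_zero ν hf hpos).eventually_lt_const hc).and
    self_mem_nhdsWithin).exists
  obtain ⟨η, hη, h⟩ := isPreconnected_Ioi.intermediate_value ha hb
    (hG.continuousOn_integral_mul ν hf hpos) ⟨hac.le, hbc.le⟩
  exact ⟨η, hη, h⟩

end Integral

/-! ### Spherical caps and concentration at a point -/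

section Sphere

open Metric Pointwise

instance : IsFiniteMeasure (sphMeasure n) :=
  inferInstanceAs (IsFiniteMeasure (volume : Measure (E n)).toSphere)

instance : (sphMeasure n).IsOpenPosMeasure :=
  inferInstanceAs ((volume : Measure (E n)).toSphere.IsOpenPosMeasure)

theorem dim_ne_zero [h : Nonempty (Sph n)] : n ≠ 0 := by
  rintro rfl
  obtain ⟨u⟩ := h
  have h1 := norm_sph u
  rw [Subsingleton.elim (u : E 0) 0, norm_zero] at h1
  exact zero_ne_one h1

theorem sphMeasure_ne_zero [Nonempty (Sph n)] : sphMeasure n ≠ 0 := fun h =>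
  isOpen_univ.measure_ne_zero (sphMeasure n) univ_nonempty (by simp [h])

/-- A point `x` of the ball is within `2 * r` of `‖x‖ • u` and has norm above `3 / 8`, so its
direction is within `16 * r / 3` of `u`. -/
theorem ball_subset_sector (u : Sph n) {t r ε : ℝ} (ht : 1 / 2 ≤ t) (ht' : t ≤ 3 / 4)
    (hr : r ≤ 1 / 8) (hrε : 8 * r ≤ ε) :
    ball (t • (u : E n)) r ⊆ Ioo (0 : ℝ) 1 • (Subtype.val '' ball u ε : Set (E n)) := by
  intro x hx
  rw [mem_ball, dist_eq_norm] at hx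
  have htu : ‖t • (u : E n)‖ = t := by
    rw [norm_smul, norm_sph, mul_one, Real.norm_of_nonneg]; linarith
  have habs := abs_le.1 (abs_norm_sub_norm_le x (t • (u : E n)))
  rw [htu] at habs
  have hx0 : 3 / 8 < ‖x‖ := by linarith
  have hpos : 0 < ‖x‖ := by linarith
  have hunit : ‖‖x‖⁻¹ • x‖ = 1 := by rw [norm_smul, norm_inv, norm_norm, inv_mul_cancel₀ hpos.ne']
  refine ⟨‖x‖, ⟨hpos, by linarith⟩, ‖x‖⁻¹ • x,
    ⟨⟨‖x‖⁻¹ • x, by rw [mem_sphere_zero_iff_norm, hunit]⟩, ?_, rfl⟩, ?_⟩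
  · rw [mem_ball, Subtype.dist_eq, dist_eq_norm]
    have h1 : ‖x‖⁻¹ • x - (u : E n) = ‖x‖⁻¹ • ((x - t • (u : E n)) + (t - ‖x‖) • (u : E n)) := by
      rw [sub_smul, sub_add_sub_cancel, smul_sub, smul_smul ‖x‖⁻¹ ‖x‖, inv_mul_cancel₀ hpos.ne',
        one_smul]
    have h2 : ‖(x - t • (u : E n)) + (t - ‖x‖) • (u : E n)‖ < 2 * r := by
      refine (norm_add_le _ _).trans_lt ?_
      rw [norm_smul, norm_sph, mul_one, Real.norm_eq_abs]
      have : |t - ‖x‖| ≤ ‖x - t • (u : E n)‖ := abs_le.2 ⟨by linarith, by linarith⟩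
      linarith
    simp only [h1]
    rw [norm_smul, norm_inv, norm_norm, inv_mul_lt_iff₀ hpos]
    have hr0 : 0 < r := (norm_nonneg _).trans_lt hx
    nlinarith
  · simp only [smul_smul, mul_inv_cancel₀ hpos.ne', one_smul]

/-- A spherical cap of radius `1 / m` has measure at least of order `m ^ (1 - n)`. -/
theorem exists_le_pow_mul_sphMeasure_ball [Nonempty (Sph n)] :
    ∃ c : ENNReal, c ≠ 0 ∧ ∀ (u : Sph n) (m : ℕ), 1 ≤ m →
      c ≤ (m : ENNReal) ^ (n - 1) * sphMeasure n (ball u (1 / (m : ℝ))) := by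
  have hn := dim_ne_zero (n := n)
  refine ⟨n * (ENNReal.ofReal (1 / 8) ^ n * volume (ball (0 : E n) 1)), ?_, fun u m hm => ?_⟩
  · have h1 : volume (ball (0 : E n) 1) ≠ 0 := (measure_ball_pos _ _ one_pos).ne'
    have h2 : ENNReal.ofReal (1 / 8) ≠ 0 := by simp
    exact mul_ne_zero (by exact_mod_cast hn) (mul_ne_zero (pow_ne_zero _ h2) h1)
  have hm0 : (0 : ℝ) < m := by exact_mod_cast hm
  have hm1 : (1 : ℝ) ≤ m := by exact_mod_cast hm
  -- The cone over the cap contains `m` disjoint balls of radius `r`, centred at spacing `2 * r` on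
  -- the segment from `u / 2` to `3 u / 4`. Their total volume has order `m * r ^ n`, that is `m ^
  -- (1 - n)`; a single ball would lose a factor `m`.
  set r : ℝ := 1 / 8 / m with hr
  have hr0 : 0 < r := by positivity
  have hrm : r * m = 1 / 8 := by rw [hr]; field_simp
  set x : ℕ → E n := fun k => (1 / 2 + 2 * r * k) • (u : E n) with hx
  have hdisj : (↑(Finset.range m) : Set ℕ).PairwiseDisjoint fun k => ball (x k) r := by
    intro k _ l _ hkl
    refine ball_disjoint_ball ?_
    have h1 : (1 : ℝ) ≤ |(k : ℝ) - l| := by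
      have : (1 : ℤ) ≤ |(k : ℤ) - l| := Int.one_le_abs (sub_ne_zero.2 (by exact_mod_cast hkl))
      exact_mod_cast this
    have h2 : x k - x l = (2 * r * ((k : ℝ) - l)) • (u : E n) := by
      rw [hx, ← sub_smul]; congr 1; ring
    rw [dist_eq_norm, h2, norm_smul, norm_sph, mul_one, Real.norm_eq_abs, abs_mul,
      abs_of_pos (by positivity : 0 < 2 * r)]
    nlinarith
  have hsub : (⋃ k ∈ Finset.range m, ball (x k) r) ⊆
      Ioo (0 : ℝ) 1 • (Subtype.val '' ball u (1 / (m : ℝ)) : Set (E n)) := by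
    refine iUnion₂_subset fun k hk => ball_subset_sector u ?_ ?_ ?_ ?_
    · have : 0 ≤ 2 * r * k := by positivity
      linarith
    · have hkm : (k : ℝ) ≤ m := by exact_mod_cast (Finset.mem_range.1 hk).le
      have : r * k ≤ r * m := mul_le_mul_of_nonneg_left hkm hr0.le
      linarith
    · nlinarith
    · rw [hr]; apply le_of_eq; field_simp
  have hmeas := measure_mono (μ := volume) hsub
  rw [measure_biUnion_finset hdisj fun _ _ => measurableSet_ball] at hmeas
  simp only [Measure.addHaar_ball_of_pos _ _ hr0, finrank_euclideanSpace_fin, Finset.sum_const,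
    Finset.card_range, nsmul_eq_mul] at hmeas
  rw [sphMeasure, Measure.toSphere_apply' _ measurableSet_ball, finrank_euclideanSpace_fin]
  have hkey : ENNReal.ofReal (1 / 8) ^ n = (m : ENNReal) ^ (n - 1) * (m * ENNReal.ofReal (r ^ n)) := by
    rw [← mul_assoc, ← pow_succ, Nat.sub_add_cancel (Nat.one_le_iff_ne_zero.2 hn),
      ENNReal.ofReal_pow hr0.le, ← mul_pow, ← ENNReal.ofReal_natCast m,
      ← ENNReal.ofReal_mul hm0.le, mul_comm (m : ℝ), hrm]
  calc (n : ENNReal) * (ENNReal.ofReal (1 / 8) ^ n * volume (ball (0 : E n) 1))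
      = (m : ENNReal) ^ (n - 1) *
        (n * (m * (ENNReal.ofReal (r ^ n) * volume (ball (0 : E n) 1)))) := by rw [hkey]; ring
    _ ≤ _ := by gcongr

/-- The part of a function that is large near a point survives on the point itself. -/
theorem sphMeasure_singleton_ne_zero_of_growth [Nonempty (Sph n)] {F : Sph n → ENNReal}
    (hF : Measurable F) (hfin : ∫⁻ u, F u ∂(sphMeasure n) ≠ ⊤) (u : Sph n) {c : ENNReal}
    (hc : c ≠ 0) {R : ℕ} (hR : 1 ≤ R) {k₀ : ℕ}
    (h : ∀ k : ℕ, k₀ ≤ k → ∀ v ∈ ball u (1 / ((R * k : ℕ) : ℝ)), c * (k : ENNReal) ^ (n - 1) ≤ F v) :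
    sphMeasure n {u} ≠ 0 := by
  obtain ⟨d, hd, hcap⟩ := exists_le_pow_mul_sphMeasure_ball (n := n)
  set ν := (sphMeasure n).withDensity F
  set s : ℕ → Set (Sph n) := fun k => ball u (1 / ((R * k : ℕ) : ℝ))
  have hlow : ∀ k : ℕ, max k₀ 1 ≤ k → c * (d / (R : ENNReal) ^ (n - 1)) ≤ ν (s k) := by
    intro k hk
    have h1 : ∫⁻ _ in s k, c * (k : ENNReal) ^ (n - 1) ∂(sphMeasure n) ≤ ν (s k) := by
      rw [withDensity_apply _ measurableSet_ball]
      exact setLIntegral_mono hF (h k ((le_max_left _ _).trans hk))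
    refine le_trans ?_ h1
    rw [setLIntegral_const, mul_assoc]
    gcongr
    have hRk : 1 ≤ R * k := Nat.one_le_iff_ne_zero.2
      (mul_ne_zero (by omega) (by have := (le_max_right k₀ 1).trans hk; omega))
    refine ENNReal.div_le_of_le_mul ?_
    refine (hcap u (R * k) hRk).trans (le_of_eq ?_)
    simp only [s, Nat.cast_mul (α := ENNReal), mul_pow]
    ring
  -- The index is shifted because `1 / 0 = 0` makes `s 0` empty.
  have hanti : Antitone fun k => s (k + 1) := by
    intro k l hkl
    refine ball_subset_ball (one_div_le_one_div_of_le ?_ ?_)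
    · exact_mod_cast Nat.mul_pos (by omega) (Nat.succ_pos k)
    · exact_mod_cast Nat.mul_le_mul_left R (Nat.succ_le_succ hkl)
  have hinter : ⋂ k, s (k + 1) = {u} := by
    refine Subset.antisymm (fun v hv => ?_) ?_
    · rw [mem_iInter] at hv
      refine mem_singleton_iff.2 (dist_le_zero.1 (ge_of_tendsto'
        (tendsto_one_div_add_atTop_nhds_zero_nat (𝕜 := ℝ)) fun k => (mem_ball.1 (hv k)).le.trans ?_))
      refine one_div_le_one_div_of_le (by positivity) ?_
      have : (k + 1) ≤ R * (k + 1) := Nat.le_mul_of_pos_left _ (by omega)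
      exact_mod_cast this
    · rw [singleton_subset_iff, mem_iInter]
      intro k
      refine mem_ball_self (one_div_pos.2 ?_)
      exact_mod_cast Nat.mul_pos (by omega) (Nat.succ_pos k)
  have hνfin : ν univ ≠ ⊤ := by rwa [withDensity_apply _ .univ, Measure.restrict_univ]
  have hlim := tendsto_measure_iInter_atTop (μ := ν)
    (fun k => (measurableSet_ball (x := u)).nullMeasurableSet) hanti
    ⟨0, ne_top_of_le_ne_top hνfin (measure_mono (subset_univ _))⟩
  rw [hinter] at hlim
  have hge : c * (d / (R : ENNReal) ^ (n - 1)) ≤ ν {u} := by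
    refine ge_of_tendsto hlim ?_
    filter_upwards [eventually_ge_atTop (max k₀ 1)] with k hk
    exact hlow _ (hk.trans (Nat.le_succ k))
  -- `ν` is absolutely continuous with respect to `sphMeasure n`, so an atom of `ν` forces one of
  -- the surface measure.
  intro h0
  rw [withDensity_absolutelyContinuous _ _ h0, nonpos_iff_eq_zero] at hge
  refine mul_ne_zero hc (ENNReal.div_ne_zero.2 ⟨hd, ?_⟩) hge
  simp

end Sphere

/-! ### Existence of minimizers -/

section Existence

open Metric

variable {φ : ℝ → ℝ} {μ : Measure (Sph n)} {G : ℝ → Sph n → ℝ}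

/-- Lets the continuity and convergence results for `G` serve the objective as well. -/
theorem ClassI.classGI (hφ : ClassI φ) : ClassGI fun t (_ : Sph n) => φ t where
  pos t _ ht := hφ.pos t ht
  continuousOn := hφ.continuousOn.comp continuousOn_fst fun _ hp => hp.1
  strictMonoOn _ := hφ.strictMonoOn
  tendsto_zero _ := hφ.tendsto_zero
  tendsto_top _ := hφ.tendsto_top

theorem measure_inner_pos_ne_zero (hμ : ¬ ConcentratedOnHemisphere μ) (v : Sph n) :
    μ {u : Sph n | 0 < inner ℝ (u : E n) (v : E n)} ≠ 0 := by
  refine fun h => hμ ⟨-v, ?_⟩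
  convert h using 2
  ext u
  simp

/-- A measure not concentrated on a closed hemisphere gives mass to all open hemispheres,
uniformly. -/
theorem exists_le_measureReal_inner [IsFiniteMeasure μ] [Nonempty (Sph n)]
    (hμ : ¬ ConcentratedOnHemisphere μ) :
    ∃ δ, 0 < δ ∧ ∀ v : Sph n, δ ≤ μ.real {u : Sph n | δ ≤ inner ℝ (u : E n) (v : E n)} := by
  set I : Sph n → ℝ := fun v => ∫ u, max (inner ℝ (u : E n) (v : E n)) 0 ∂μ
  have hle : ∀ u v : Sph n, max (inner ℝ (u : E n) (v : E n)) 0 ≤ (1 : ℝ) := fun u v => by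
    have := real_inner_le_norm (u : E n) (v : E n)
    rw [norm_sph, norm_sph, one_mul] at this
    exact max_le this zero_le_one
  have hcont : ∀ v : Sph n, Continuous fun u : Sph n => max (inner ℝ (u : E n) (v : E n)) (0 : ℝ) :=
    fun v => by fun_prop
  have hI : Continuous I := by
    refine continuous_of_dominated (bound := fun _ => 1)
      (fun v => (hcont v).aestronglyMeasurable) (fun v => ae_of_all _ fun u => ?_)
      (integrable_const _) (ae_of_all _ fun u => by fun_prop)
    rw [Real.norm_of_nonneg (le_max_right _ _)]
    exact hle u v
  obtain ⟨v₀, -, hv₀⟩ := isCompact_univ.exists_isMinOn (univ_nonempty (α := Sph n)) hI.continuousOn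
  have hpos : 0 < I v₀ := by
    have := integral_lt_integral_of_continuous μ continuous_const (hcont v₀)
      (fun u => le_max_right _ _) (by simpa using measure_inner_pos_ne_zero hμ v₀)
    simpa using this
  set M : ℝ := μ.real univ
  have hM : 0 ≤ M := measureReal_nonneg
  -- With `A = {δ ≤ ⟨u, v⟩}`, splitting the integrand gives `I v ≤ μ(A) + M * δ`. As `I v ≥ I v₀ = δ
  -- * (M + 1)`, this leaves `μ(A) ≥ δ`.
  refine ⟨I v₀ / (M + 1), by positivity, fun v => ?_⟩
  set δ : ℝ := I v₀ / (M + 1) with hδ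
  have hδ0 : 0 < δ := by positivity
  set A : Set (Sph n) := {u : Sph n | δ ≤ inner ℝ (u : E n) (v : E n)}
  have hA : MeasurableSet A := (isClosed_le continuous_const (by fun_prop)).measurableSet
  have h1 : I v ≤ ∫ u, (A.indicator (fun _ => (1 : ℝ)) u + δ) ∂μ := by
    refine integral_mono (integrable_of_continuous μ (hcont v))
      (((integrable_const _).indicator hA).add (integrable_const _)) fun u => ?_
    by_cases hu : u ∈ A
    · simp only [indicator_of_mem hu]
      linarith [hle u v]
    · simp only [indicator_of_notMem hu, zero_add]
      exact max_le (not_le.1 hu).le hδ0.le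
  rw [integral_add ((integrable_const _).indicator hA) (integrable_const _), integral_indicator hA,
    setIntegral_const, integral_const] at h1
  have h2 : I v₀ ≤ I v := hv₀ (mem_univ v)
  have h3 : δ * (M + 1) = I v₀ := by rw [hδ]; field_simp
  simp only [smul_eq_mul, mul_one] at h1
  have h4 : M * δ = μ.real univ * δ := rfl
  linarith

theorem exists_norm_le_of_objective_le [IsFiniteMeasure μ] [Nonempty (Sph n)] (hφ : ClassI φ)
    (hμ : ¬ ConcentratedOnHemisphere μ) (C : ℝ) :
    ∃ R, ∀ Q ∈ bodiesO n, objective φ μ Q ≤ C → ∀ x ∈ Q, ‖x‖ ≤ R := by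
  obtain ⟨δ, hδ, hδA⟩ := exists_le_measureReal_inner hμ
  -- A point of norm above `T / δ` forces `φ(h_Q) ≥ (|C| + 1) / δ` on a set of mass at least `δ`;
  -- Markov then gives an objective of at least `|C| + 1 > C`.
  obtain ⟨T, hT⟩ := (hφ.tendsto_top.eventually_ge_atTop ((|C| + 1) / δ)).exists_forall_of_atTop
  refine ⟨max T 1 / δ, fun Q hQ hC x hx => ?_⟩
  by_contra! hxR
  rw [div_lt_iff₀ hδ] at hxR
  have hx0 : 0 < ‖x‖ := by
    have : 0 < ‖x‖ * δ := (by positivity : (0 : ℝ) < max T 1).trans hxR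
    exact pos_of_mul_pos_left this hδ.le
  set v : Sph n := ⟨‖x‖⁻¹ • x, by simp [norm_smul, hx0.ne']⟩ with hv
  set f : Sph n → ℝ := fun u => φ (supportFun (Q : Set (E n)) u)
  have hf : Continuous f := hφ.classGI.continuous_comp
    (continuous_supportFun Q.isCompact Q.nonempty) (supportFun_pos hQ)
  have hsub : {u : Sph n | δ ≤ inner ℝ (u : E n) (v : E n)} ⊆ {u | (|C| + 1) / δ ≤ f u} := by
    intro u (hu : δ ≤ inner ℝ (u : E n) (v : E n))
    refine hT _ ?_
    have h1 := inner_le_supportFun Q.isCompact hx u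
    have h2 : inner ℝ x (u : E n) = ‖x‖ * inner ℝ (u : E n) (v : E n) := by
      rw [hv, real_inner_smul_right, ← mul_assoc, mul_inv_cancel₀ hx0.ne', one_mul,
        real_inner_comm]
    have h3 := mul_le_mul_of_nonneg_left hu hx0.le
    linarith [le_max_left T 1]
  have h1 := mul_meas_ge_le_integral_of_nonneg (μ := μ) (ae_of_all _ fun u => (hφ.pos _
    (supportFun_pos hQ u)).le) (integrable_of_continuous μ hf) ((|C| + 1) / δ)
  have h2 : δ ≤ μ.real {u | (|C| + 1) / δ ≤ f u} := (hδA v).trans (measureReal_mono hsub)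
  have h3 := mul_le_mul_of_nonneg_left h2 (by positivity : 0 ≤ (|C| + 1) / δ)
  rw [div_mul_cancel₀ _ hδ.ne'] at h3
  have h4 : ∫ u, f u ∂μ ≤ C := hC
  linarith [le_abs_self C]

theorem dualVol_polarBody {Q : ConvexBody (E n)} (hQ : Q ∈ bodiesO n) :
    dualVol G (polarBody (Q : Set (E n)))
      = ∫ u, G (1 / supportFun (Q : Set (E n)) u) u ∂(sphMeasure n) := by
  unfold dualVol
  congr 1 with u
  rw [radialFun_polarBody Q.isCompact (supportFun_pos hQ u) Q.nonempty]

theorem dualVol_unitBall : dualVol G (unitBall n) = ∫ u, G 1 u ∂(sphMeasure n) := by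
  simp only [dualVol, radialFun_unitBall]

theorem continuous_one_div_supportFun {Q : ConvexBody (E n)} (hQ : Q ∈ bodiesO n) :
    Continuous fun u => 1 / supportFun (Q : Set (E n)) u :=
  continuous_const.div (continuous_supportFun Q.isCompact Q.nonempty)
    fun u => (supportFun_pos hQ u).ne'

theorem mem_tildeB_iff {Q : ConvexBody (E n)} : Q ∈ tildeB G ↔ Q ∈ bodiesO n ∧
    ∫ u, G (1 / supportFun (Q : Set (E n)) u) u ∂(sphMeasure n)
      = ∫ u, G 1 u ∂(sphMeasure n) := by
  unfold tildeB
  rw [mem_ofPred_eq, dualVol_unitBall]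
  exact and_congr_right fun hQ => by rw [dualVol_polarBody hQ]

theorem tildeB_nonempty [Nonempty (Sph n)] : (tildeB G).Nonempty := by
  refine ⟨⟨closedBall 0 1, convex_closedBall _ _, isCompact_closedBall _ _,
    nonempty_closedBall.2 zero_le_one⟩, mem_tildeB_iff.2 ?_⟩
  simp only [mem_bodiesO_iff, ConvexBody.coe_mk, supportFun_closedBall zero_le_one, div_one,
    zero_lt_one, implies_true, and_self]

theorem objective_nonneg (hφ : ClassI φ) {Q : ConvexBody (E n)} (hQ : Q ∈ bodiesO n) :
    0 ≤ objective φ μ Q :=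
  integral_nonneg fun u => (hφ.pos _ (supportFun_pos hQ u)).le

theorem bddBelow_objective (hφ : ClassI φ) : BddBelow (objective φ μ '' tildeB G) :=
  ⟨0, by rintro _ ⟨Q, hQ, rfl⟩; exact objective_nonneg hφ hQ.1⟩

/-- Under the growth condition, limits of bodies whose polars have bounded general dual volume
contain the origin in their interiors. -/
theorem supportFun_pos_of_tendsto [Nonempty (Sph n)] (hG : ClassGI G) {c T : ℝ} (hc : 0 < c)
    (hgr : ∀ t, T ≤ t → ∀ u, c * t ^ (n - 1) ≤ G t u) {Q : ℕ → ConvexBody (E n)}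
    {L : ConvexBody (E n)} (hQ : ∀ i, Q i ∈ bodiesO n) {V : ℝ}
    (hV : ∀ i, ∫ u, G (1 / supportFun (Q i : Set (E n)) u) u ∂(sphMeasure n) ≤ V)
    (hlim : ∀ u, Tendsto (fun i => supportFun (Q i : Set (E n)) u) atTop
      (𝓝 (supportFun (L : Set (E n)) u))) (u : Sph n) :
    0 < supportFun (L : Set (E n)) u := by
  by_contra! hu
  have hu0 : supportFun (L : Set (E n)) u = 0 :=
    le_antisymm hu (ge_of_tendsto' (hlim u) fun i => (supportFun_pos (hQ i) u).le)
  set F : Sph n → ENNReal :=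
    fun v => liminf (fun i => ENNReal.ofReal (G (1 / supportFun (Q i : Set (E n)) v) v)) atTop
  have hcont : ∀ i, Continuous fun v => G (1 / supportFun (Q i : Set (E n)) v) v := fun i =>
    hG.continuous_comp (continuous_one_div_supportFun (hQ i))
      fun v => one_div_pos.2 (supportFun_pos (hQ i) v)
  have hF : Measurable F := .liminf fun i => (hcont i).measurable.ennreal_ofReal
  have hfin : ∫⁻ v, F v ∂(sphMeasure n) ≠ ⊤ := ne_top_of_le_ne_top ENNReal.ofReal_ne_top
    (lintegral_liminf_le_of_integral_le (sphMeasure n) hcont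
      (fun i v => (hG.pos _ v (one_div_pos.2 (supportFun_pos (hQ i) v))).le) hV)
  obtain ⟨R₀, hR₀⟩ := L.isCompact.isBounded.exists_norm_le
  obtain ⟨R, hR⟩ := exists_nat_ge (max R₀ 1)
  have hR1 : (1 : ℝ) ≤ R := (le_max_right _ _).trans hR
  obtain ⟨k₀, hk₀⟩ := exists_nat_ge (max T 1)
  have hne : sphMeasure n {u} ≠ 0 := by
    refine sphMeasure_singleton_ne_zero_of_growth hF hfin u (c := ENNReal.ofReal c) (by simpa)
      (R := R) (by exact_mod_cast hR1) (k₀ := k₀) fun k hk v hv => ?_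
    have hkk : max T 1 ≤ (k : ℝ) := hk₀.trans (by exact_mod_cast hk)
    have hk1 : (1 : ℝ) ≤ k := (le_max_right _ _).trans hkk
    -- Lipschitz bound from `h_L u = 0`. Its strictness lets `h_{Q i} v < 1 / k` hold for all large
    -- `i`.
    have hlt : supportFun (L : Set (E n)) v < 1 / k := by
      have h1 := supportFun_le_add L.isCompact L.nonempty
        (fun x hx => (hR₀ x hx).trans ((le_max_left _ _).trans hR)) v u
      rw [hu0, zero_add] at h1
      refine h1.trans_lt ?_
      rw [mem_ball, Nat.cast_mul, ← div_div, lt_div_iff₀ (by positivity),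
        lt_div_iff₀ (by positivity)] at hv
      rw [lt_div_iff₀ (by positivity)]
      linarith
    refine le_liminf_of_le (by isBoundedDefault) ?_
    filter_upwards [(hlim v).eventually_lt_const hlt] with i hi
    have hki : (k : ℝ) ≤ 1 / supportFun (Q i : Set (E n)) v :=
      (le_one_div (by positivity) (supportFun_pos (hQ i) v)).2 hi.le
    rw [← ENNReal.ofReal_natCast, ← ENNReal.ofReal_pow (by positivity), ← ENNReal.ofReal_mul hc.le]
    refine ENNReal.ofReal_le_ofReal (le_trans ?_ (hgr _ (((le_max_left _ _).trans hkk).trans hki) v))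
    gcongr
  have htop : F u = ⊤ := by
    refine liminf_ofReal_eq_top ((hG.tendsto_top u).comp ?_)
    simp only [one_div]
    refine tendsto_inv_nhdsGT_zero.comp (tendsto_nhdsWithin_iff.2 ⟨hu0 ▸ hlim u, ?_⟩)
    exact Eventually.of_forall fun i => supportFun_pos (hQ i) u
  refine hfin (top_le_iff.1 ?_)
  calc (⊤ : ENNReal) = F u * sphMeasure n {u} := by rw [htop, ENNReal.top_mul hne]
    _ = ∫⁻ v in {u}, F v ∂(sphMeasure n) := (lintegral_singleton _ _).symm
    _ ≤ _ := setLIntegral_le_lintegral _ _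

theorem exists_isSolution_tildeB [IsFiniteMeasure μ] [Nonempty (Sph n)] (hφ : ClassI φ)
    (hμ : ¬ ConcentratedOnHemisphere μ) (hG : ClassGI G) {c T : ℝ} (hc : 0 < c)
    (hgr : ∀ t, T ≤ t → ∀ u, c * t ^ (n - 1) ≤ G t u) :
    ∃ M, IsSolution φ μ (tildeB G) M := by
  obtain ⟨x, hx, hxlim, hxmem⟩ := exists_seq_tendsto_sInf (tildeB_nonempty.image (objective φ μ))
    (bddBelow_objective (G := G) hφ)
  choose Q hQ hQx using hxmem
  obtain ⟨R, hR⟩ := exists_norm_le_of_objective_le hφ hμ (x 0)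
  have hQR : ∀ i, ∀ y ∈ Q i, ‖y‖ ≤ R := fun i =>
    hR (Q i) (hQ i).1 ((hQx i).trans_le (hx (Nat.zero_le i)))
  obtain ⟨L, s, hs, hLR, hunif⟩ := exists_subseq_tendsto_supportFun Q hQR
  have hlim := fun u => hunif.tendsto_at u
  have hpos : ∀ u, 0 < supportFun (L : Set (E n)) u :=
    supportFun_pos_of_tendsto hG hc hgr (fun i => (hQ (s i)).1)
      (fun i => (mem_tildeB_iff.1 (hQ (s i))).2.le) hlim
  have hL : L ∈ bodiesO n := mem_bodiesO_iff.2 hpos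
  have hR0 : 0 < R := (hpos (Classical.arbitrary _)).trans_le
    (supportFun_le L.isCompact L.nonempty hLR _)
  obtain ⟨u₀, -, hu₀⟩ := isCompact_univ.exists_isMinOn (univ_nonempty (α := Sph n))
    (continuous_supportFun L.isCompact L.nonempty).continuousOn
  set a := supportFun (L : Set (E n)) u₀
  have ha : 0 < a := hpos u₀
  -- Uniform convergence keeps `h_{Q (s i)}` above half the minimum `a` of `h_L` eventually, whence
  -- the bound `1 / (a / 2)`.
  have hvol := hG.tendsto_integral (sphMeasure n) (l := atTop)
    (F := fun i u => 1 / supportFun (Q (s i) : Set (E n)) u)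
    (f := fun u => 1 / supportFun (L : Set (E n)) u) (b := 1 / (a / 2)) (by positivity) ?_
    (fun u => one_div_pos.2 (hpos u)) (fun u => tendsto_const_nhds.div (hlim u) (hpos u).ne')
  · have hobj := hφ.classGI.tendsto_integral μ (l := atTop)
      (F := fun i u => supportFun (Q (s i) : Set (E n)) u) hR0
      (Eventually.of_forall fun i => ⟨continuous_supportFun (Q (s i)).isCompact (Q (s i)).nonempty,
        fun u => ⟨supportFun_pos (hQ (s i)).1 u,
          supportFun_le (Q (s i)).isCompact (Q (s i)).nonempty (hQR (s i)) u⟩⟩) hpos hlim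
    refine ⟨L, mem_tildeB_iff.2 ⟨hL, ?_⟩, ?_⟩
    · refine tendsto_nhds_unique hvol ?_
      simp only [fun i => (mem_tildeB_iff.1 (hQ (s i))).2]
      exact tendsto_const_nhds
    · refine tendsto_nhds_unique hobj ?_
      convert hxlim.comp hs.tendsto_atTop using 2 with i
      exact hQx (s i)
  · filter_upwards [Metric.tendstoUniformly_iff.1 hunif (a / 2) (by positivity)] with i hi
    refine ⟨continuous_one_div_supportFun (hQ (s i)).1, fun u =>
      ⟨one_div_pos.2 (supportFun_pos (hQ (s i)).1 u), one_div_le_one_div_of_le (by positivity) ?_⟩⟩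
    have h1 := (abs_lt.1 (hi u)).2
    have h2 : a ≤ supportFun (L : Set (E n)) u := hu₀ (mem_univ u)
    linarith

end Existence

/-! ### Uniqueness under convexity -/

section Uniqueness

variable {φ : ℝ → ℝ} {μ : Measure (Sph n)} {G : ℝ → Sph n → ℝ}

theorem one_div_midpoint_le {a b : ℝ} (ha : 0 < a) (hb : 0 < b) :
    1 / ((a + b) / 2) ≤ (1 / a + 1 / b) / 2 := by
  rw [← sub_nonneg, show (1 / a + 1 / b) / 2 - 1 / ((a + b) / 2)
    = (a - b) ^ 2 / (2 * a * b * (a + b)) by field_simp; ring]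
  positivity

theorem one_div_midpoint_lt {a b : ℝ} (ha : 0 < a) (hb : 0 < b) (hab : a ≠ b) :
    1 / ((a + b) / 2) < (1 / a + 1 / b) / 2 := by
  rw [← sub_pos, show (1 / a + 1 / b) / 2 - 1 / ((a + b) / 2)
    = (a - b) ^ 2 / (2 * a * b * (a + b)) by field_simp; ring]
  have := sub_ne_zero.2 hab
  positivity

theorem apply_midpoint_le_of_convexOn {f : ℝ → ℝ} (hf : ConvexOn ℝ (Ioi 0) f) {a b : ℝ} (ha : 0 < a)
    (hb : 0 < b) : f ((a + b) / 2) ≤ (f a + f b) / 2 := by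
  have h := hf.2 ha hb (by norm_num : (0 : ℝ) ≤ 1 / 2) (by norm_num : (0 : ℝ) ≤ 1 / 2) (by norm_num)
  simp only [smul_eq_mul] at h
  rw [show (a + b) / 2 = 1 / 2 * a + 1 / 2 * b by ring]
  linarith

/-- Strictness comes from the strict convexity of `1 / t` and the strict monotonicity of `G`, on the
nonempty open set where `f` and `g` differ. -/
theorem ClassGI.integral_one_div_midpoint_lt (hG : ClassGI G)
    (hconv : ∀ u, ConvexOn ℝ (Ioi 0) fun t => G t u) {f g : Sph n → ℝ} (hf : Continuous f)
    (hg : Continuous g) (hf0 : ∀ u, 0 < f u) (hg0 : ∀ u, 0 < g u) {u₀ : Sph n}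
    (hne : f u₀ ≠ g u₀) :
    ∫ u, G (1 / ((f u + g u) / 2)) u ∂(sphMeasure n) <
      (∫ u, G (1 / f u) u ∂(sphMeasure n) + ∫ u, G (1 / g u) u ∂(sphMeasure n)) / 2 := by
  have hm0 : ∀ u, 0 < (f u + g u) / 2 := fun u => by linarith [hf0 u, hg0 u]
  have hf' : Continuous fun u => G (1 / f u) u := hG.continuous_comp
    (continuous_const.div hf fun u => (hf0 u).ne') fun u => one_div_pos.2 (hf0 u)
  have hg' : Continuous fun u => G (1 / g u) u := hG.continuous_comp
    (continuous_const.div hg fun u => (hg0 u).ne') fun u => one_div_pos.2 (hg0 u)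
  have hmid : ∀ u, G ((1 / f u + 1 / g u) / 2) u ≤ (G (1 / f u) u + G (1 / g u) u) / 2 := fun u =>
    apply_midpoint_le_of_convexOn (hconv u) (one_div_pos.2 (hf0 u)) (one_div_pos.2 (hg0 u))
  rw [← integral_add (integrable_of_continuous _ hf') (integrable_of_continuous _ hg'),
    ← integral_div]
  refine integral_lt_integral_of_continuous _ (hG.continuous_comp
    (continuous_const.div (by fun_prop) fun u => (hm0 u).ne') fun u => one_div_pos.2 (hm0 u))
    ((hf'.add hg').div_const 2) (fun u => ?_) ?_
  · exact (hG.mono (one_div_pos.2 (hm0 u)) (one_div_midpoint_le (hf0 u) (hg0 u)) u).trans (hmid u)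
  · have hopen : IsOpen {u | f u ≠ g u} := isOpen_ne_fun hf hg
    refine fun h => hopen.measure_ne_zero (sphMeasure n) ⟨u₀, hne⟩ (measure_mono_null ?_ h)
    intro u hu
    have h1 := one_div_midpoint_lt (hf0 u) (hg0 u) hu
    have h2 : 0 < 1 / ((f u + g u) / 2) := one_div_pos.2 (hm0 u)
    exact (hG.strictMonoOn u h2 (h2.trans h1) h1).trans_le (hmid u)

theorem eq_of_isSolution_tildeB [IsFiniteMeasure μ] [Nonempty (Sph n)] (hφ : ClassI φ)
    (hμ0 : μ ≠ 0) (hG : ClassGI G) (hφc : ConvexOn ℝ (Ioi 0) φ)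
    (hGc : ∀ u, ConvexOn ℝ (Ioi 0) fun t => G t u) {M₁ M₂ : ConvexBody (E n)}
    (h₁ : IsSolution φ μ (tildeB G) M₁) (h₂ : IsSolution φ μ (tildeB G) M₂) : M₁ = M₂ := by
  refine convexBody_ext_supportFun ?_
  by_contra! hex
  obtain ⟨u₀, hne⟩ := hex
  obtain ⟨hB₁, hobj₁⟩ := h₁
  obtain ⟨hB₂, hobj₂⟩ := h₂
  obtain ⟨hM₁, hV₁⟩ := mem_tildeB_iff.1 hB₁
  obtain ⟨hM₂, hV₂⟩ := mem_tildeB_iff.1 hB₂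
  set f₁ := supportFun (M₁ : Set (E n))
  set f₂ := supportFun (M₂ : Set (E n))
  have hc₁ : Continuous f₁ := continuous_supportFun M₁.isCompact M₁.nonempty
  have hc₂ : Continuous f₂ := continuous_supportFun M₂.isCompact M₂.nonempty
  have hp₁ : ∀ u, 0 < f₁ u := supportFun_pos hM₁
  have hp₂ : ∀ u, 0 < f₂ u := supportFun_pos hM₂
  set f : Sph n → ℝ := fun u => (f₁ u + f₂ u) / 2
  have hc : Continuous f := by fun_prop
  have hp : ∀ u, 0 < f u := fun u => by have := hp₁ u; have := hp₂ u; positivity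
  have hlt := hG.integral_one_div_midpoint_lt hGc hc₁ hc₂ hp₁ hp₂ hne
  rw [hV₁, hV₂, add_self_div_two] at hlt
  have hc' : Continuous fun u => 1 / f u := continuous_const.div hc fun u => (hp u).ne'
  have hp' : ∀ u, 0 < 1 / f u := fun u => one_div_pos.2 (hp u)
  obtain ⟨η, hη, hηV⟩ := hG.exists_integral_mul_eq (sphMeasure n) sphMeasure_ne_zero hc' hp'
    (c := ∫ u, G 1 u ∂(sphMeasure n)) (lt_of_le_of_lt (integral_nonneg fun u =>
      (hG.pos _ u (hp' u)).le) hlt)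
  -- The midpoint's polar volume is strictly below the required value, so its radial function must
  -- be enlarged, that is, the body shrunk.
  have hη1 : 1 < η := by
    by_contra! hη1
    refine hlt.not_ge (hηV ▸ integral_mono
      (integrable_of_continuous _ (hG.continuous_comp (by fun_prop) fun u => mul_pos hη (hp' u)))
      (integrable_of_continuous _ (hG.continuous_comp hc' hp')) fun u => ?_)
    exact hG.mono (mul_pos hη (hp' u)) (mul_le_of_le_one_left (hp' u).le hη1) u
  set Q : ConvexBody (E n) := η⁻¹ • (1 / 2 : ℝ) • (M₁ + M₂)
  have hQ : ∀ u, supportFun (Q : Set (E n)) u = η⁻¹ * f u := fun u => by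
    rw [supportFun_smul _ (by positivity), supportFun_smul _ (by norm_num), supportFun_add]
    ring
  have hQp : ∀ u, 0 < η⁻¹ * f u := fun u => mul_pos (inv_pos.2 hη) (hp u)
  have hQmem : Q ∈ tildeB G := by
    refine mem_tildeB_iff.2 ⟨mem_bodiesO_iff.2 fun u => (hQ u).symm ▸ hQp u, ?_⟩
    rw [← hηV]
    congr 1 with u
    rw [hQ, one_div, mul_inv, inv_inv, one_div]
  have hobj : objective φ μ Q < ∫ u, φ (f u) ∂μ := by
    simp only [objective, hQ]
    exact hφ.classGI.integral_lt μ hμ0 (by fun_prop) hc hQp fun u =>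
      mul_lt_of_lt_one_left (hp u) (inv_lt_one_of_one_lt₀ hη1)
  have hφ₁ : Continuous fun u => φ (f₁ u) := hφ.classGI.continuous_comp hc₁ hp₁
  have hφ₂ : Continuous fun u => φ (f₂ u) := hφ.classGI.continuous_comp hc₂ hp₂
  have havg : ∫ u, φ (f u) ∂μ ≤ (objective φ μ M₁ + objective φ μ M₂) / 2 := by
    unfold objective
    rw [← integral_add (integrable_of_continuous _ hφ₁) (integrable_of_continuous _ hφ₂),
      ← integral_div]
    exact integral_mono (integrable_of_continuous _ (hφ.classGI.continuous_comp hc hp))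
      (integrable_of_continuous _ ((hφ₁.add hφ₂).div_const 2)) fun u => apply_midpoint_le_of_convexOn hφc (hp₁ u) (hp₂ u)
  rw [hobj₁, hobj₂, add_self_div_two] at havg
  exact (hobj.trans_le havg).not_ge (csInf_le (bddBelow_objective hφ) (mem_image_of_mem _ hQmem))

end Uniqueness

/-! ### Reduction of the homogeneous problem and the growth condition -/

section Homogeneous

variable {G : ℝ → Sph n → ℝ}

theorem ClassGI.comp_mul (hG : ClassGI G) {η : ℝ} (hη : 0 < η) :
    ClassGI fun t u => G (η * t) u where
  pos t u ht := hG.pos _ u (mul_pos hη ht)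
  continuousOn := hG.continuousOn.comp (f := fun p : ℝ × Sph n => (η * p.1, p.2)) (by fun_prop)
    fun p hp => ⟨mul_pos hη hp.1, mem_univ _⟩
  strictMonoOn u s hs t ht hst := hG.strictMonoOn u (mul_pos hη hs) (mul_pos hη ht)
    (mul_lt_mul_of_pos_left hst hη)
  tendsto_zero u := by
    refine (hG.tendsto_zero u).comp (tendsto_nhdsWithin_iff.2 ⟨?_, ?_⟩)
    · have : Tendsto (fun t : ℝ => η * t) (𝓝 0) (𝓝 (η * 0)) := tendsto_id.const_mul _
      rw [mul_zero] at this
      exact this.mono_left nhdsWithin_le_nhds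
    · filter_upwards [self_mem_nhdsWithin] with t ht
      exact mul_pos hη ht
  tendsto_top u := (hG.tendsto_top u).comp (tendsto_id.const_mul_atTop hη)

theorem convexOn_comp_mul {f : ℝ → ℝ} (hf : ConvexOn ℝ (Ioi 0) f) {η : ℝ} (hη : 0 < η) :
    ConvexOn ℝ (Ioi 0) fun t => f (η * t) := by
  refine ⟨convex_Ioi 0, fun s hs t ht a b ha hb hab => ?_⟩
  have h := hf.2 (mul_pos hη hs) (mul_pos hη ht) ha hb hab
  simp only [smul_eq_mul] at h ⊢
  rwa [mul_add, mul_left_comm η a, mul_left_comm η b]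

/-- The integral is strictly decreasing in the scaling parameter, so the admissible set is exactly
`Ici η`. -/
theorem ClassGI.homDualVol_eq [Nonempty (Sph n)] (hG : ClassGI G) {K : Set (E n)}
    (hK : Continuous (radialFun K)) (hpos : ∀ u, 0 < radialFun K u) {η : ℝ} (hη : 0 < η)
    (h : ∫ u, G (radialFun K u / η) u ∂(sphMeasure n) = 1) : homDualVol G K = η := by
  have : {s : ℝ | 0 < s ∧ ∫ u, G (radialFun K u / s) u ∂(sphMeasure n) ≤ 1} = Ici η := by
    ext s
    simp only [mem_ofPred_eq, mem_Ici]
    constructor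
    · rintro ⟨hs, hs1⟩
      by_contra! hlt
      have := hG.integral_lt (sphMeasure n) sphMeasure_ne_zero (hK.div_const η) (hK.div_const s)
        (fun u => div_pos (hpos u) hη) (fun u => div_lt_div_of_pos_left (hpos u) hs hlt)
      linarith
    · intro hs
      have hs0 : 0 < s := hη.trans_le hs
      refine ⟨hs0, le_of_le_of_eq (integral_mono
        (integrable_of_continuous _ (hG.continuous_comp (hK.div_const s) fun u =>
          div_pos (hpos u) hs0))
        (integrable_of_continuous _ (hG.continuous_comp (hK.div_const η) fun u =>
          div_pos (hpos u) hη)) fun u => ?_) h⟩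
      exact hG.mono (div_pos (hpos u) hs0) (div_le_div_of_nonneg_left (hpos u).le hη hs) u
  rw [homDualVol, this, csInf_Ici]

/-- For the forward direction, some scaling does normalize the integral to `1`, and the infimum must
be that scaling. -/
theorem ClassGI.homDualVol_eq_iff [Nonempty (Sph n)] (hG : ClassGI G) {K : Set (E n)}
    (hK : Continuous (radialFun K)) (hpos : ∀ u, 0 < radialFun K u) {η : ℝ} (hη : 0 < η) :
    homDualVol G K = η ↔ ∫ u, G (radialFun K u / η) u ∂(sphMeasure n) = 1 := by
  refine ⟨fun h => ?_, hG.homDualVol_eq hK hpos hη⟩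
  obtain ⟨s, hs, hs1⟩ := hG.exists_integral_mul_eq (sphMeasure n) sphMeasure_ne_zero hK hpos
    one_pos
  have h1 : ∫ u, G (radialFun K u / s⁻¹) u ∂(sphMeasure n) = 1 := by
    simpa only [div_inv_eq_mul, mul_comm _ s] using hs1
  rwa [← h, hG.homDualVol_eq hK hpos (inv_pos.2 hs) h1]

/-- The homogeneous constraint is a general dual volume constraint for a rescaled function. -/
theorem ClassGI.exists_hatB_eq_tildeB [Nonempty (Sph n)] (hG : ClassGI G) :
    ∃ η, 0 < η ∧ hatB G = tildeB fun t u => G (η * t) u := by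
  -- Normalized by `∫ G(η, u) du = 1`: the ball then has homogeneous volume `η⁻¹`, and both
  -- constraints read `∫ G(η / h_Q(u), u) du = 1`.
  obtain ⟨η, hη, hη1⟩ := hG.exists_integral_mul_eq (sphMeasure n) sphMeasure_ne_zero
    (f := fun _ => 1) continuous_const (fun _ => one_pos) one_pos
  refine ⟨η, hη, ?_⟩
  have hball : homDualVol G (unitBall n) = η⁻¹ := by
    refine hG.homDualVol_eq ?_ ?_ (inv_pos.2 hη) ?_
    · simp only [funext radialFun_unitBall]
      exact continuous_const
    · simp only [radialFun_unitBall, zero_lt_one, implies_true]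
    · simpa only [radialFun_unitBall, div_inv_eq_mul, mul_comm _ η] using hη1
  ext Q
  rw [mem_tildeB_iff, hη1]
  unfold hatB
  rw [mem_ofPred_eq, hball]
  refine and_congr_right fun hQ => ?_
  have hrad : radialFun (polarBody (Q : Set (E n))) = fun u => 1 / supportFun (Q : Set (E n)) u :=
    funext fun u => radialFun_polarBody Q.isCompact (supportFun_pos hQ u) Q.nonempty
  rw [hG.homDualVol_eq_iff (hrad ▸ continuous_one_div_supportFun hQ)
    (fun u => hrad ▸ one_div_pos.2 (supportFun_pos hQ u)) (inv_pos.2 hη), hrad]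
  simp only [div_inv_eq_mul, mul_comm _ η]

/-- For `t ≥ 1` the exponent `q` may be lowered to `n - 1`; the natural subtraction is harmless
since a nonempty sphere forces `n ≠ 0`. -/
theorem GrowthCond.exists_mul_pow_le [Nonempty (Sph n)] (hG : ClassGI G) {q : ℝ}
    (hq : (n : ℝ) - 1 ≤ q) (h : GrowthCond G q) :
    ∃ c, 0 < c ∧ ∀ t, 1 ≤ t → ∀ u, c * t ^ (n - 1) ≤ G t u := by
  refine ⟨_, h, fun t ht u => ?_⟩
  have ht0 : 0 < t := by linarith
  have hbdd : BddBelow ((fun p : ℝ × Sph n => G p.1 p.2 / p.1 ^ q) '' (Ici 1 ×ˢ univ)) := by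
    refine ⟨0, ?_⟩
    rintro _ ⟨p, hp, rfl⟩
    have : (0 : ℝ) < p.1 := zero_lt_one.trans_le hp.1
    exact div_nonneg (hG.pos _ _ this).le (Real.rpow_nonneg this.le _)
  have hle := csInf_le (a := G t u / t ^ q) hbdd
    ⟨(t, u), ⟨ht, mem_univ u⟩, rfl⟩
  rw [le_div_iff₀ (Real.rpow_pos_of_pos ht0 _)] at hle
  refine le_trans (mul_le_mul_of_nonneg_left ?_ h.le) hle
  rw [← Real.rpow_natCast, Nat.cast_sub (Nat.one_le_iff_ne_zero.2 dim_ne_zero), Nat.cast_one]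
  exact Real.rpow_le_rpow_of_exponent_le ht hq

end Homogeneous

end DualPolarOrlicz

theorem mainTheorem1 (n : ℕ) (φ : ℝ → ℝ) (hφ : DualPolarOrlicz.ClassI φ)
    (μ : Measure (DualPolarOrlicz.Sph n)) [IsFiniteMeasure μ] (hμ0 : μ ≠ 0)
    (hμ : ¬ DualPolarOrlicz.ConcentratedOnHemisphere μ)
    (G : ℝ → DualPolarOrlicz.Sph n → ℝ) (hG : DualPolarOrlicz.ClassGI G)
    (hGq : ∃ q : ℝ, (n : ℝ) - 1 ≤ q ∧ DualPolarOrlicz.GrowthCond G q) :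
    ((∃ M, DualPolarOrlicz.IsSolution φ μ (DualPolarOrlicz.tildeB G) M) ∧
      (ConvexOn ℝ (Ioi 0) φ → (∀ u, ConvexOn ℝ (Ioi 0) (fun t => G t u)) →
        ∃! M, DualPolarOrlicz.IsSolution φ μ (DualPolarOrlicz.tildeB G) M)) ∧
    ((∃ M, DualPolarOrlicz.IsSolution φ μ (DualPolarOrlicz.hatB G) M) ∧
      (ConvexOn ℝ (Ioi 0) φ → (∀ u, ConvexOn ℝ (Ioi 0) (fun t => G t u)) →
        ∃! M, DualPolarOrlicz.IsSolution φ μ (DualPolarOrlicz.hatB G) M)) := by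
  -- A nonzero measure excludes the empty sphere, hence `n = 0`.
  obtain ⟨u₀⟩ : Nonempty (DualPolarOrlicz.Sph n) := by
    by_contra h
    rw [not_nonempty_iff] at h
    exact hμ0 μ.eq_zero_of_isEmpty
  have : Nonempty (DualPolarOrlicz.Sph n) := ⟨u₀⟩
  obtain ⟨q, hq, hgr⟩ := hGq
  obtain ⟨c, hc, hcG⟩ := hgr.exists_mul_pow_le hG hq
  have key : ∀ H : ℝ → DualPolarOrlicz.Sph n → ℝ, DualPolarOrlicz.ClassGI H →
      (∃ c T : ℝ, 0 < c ∧ ∀ t, T ≤ t → ∀ u, c * t ^ (n - 1) ≤ H t u) →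
      ((∀ u, ConvexOn ℝ (Ioi 0) fun t => G t u) → ∀ u, ConvexOn ℝ (Ioi 0) fun t => H t u) →
      (∃ M, DualPolarOrlicz.IsSolution φ μ (DualPolarOrlicz.tildeB H) M) ∧
      (ConvexOn ℝ (Ioi 0) φ → (∀ u, ConvexOn ℝ (Ioi 0) (fun t => G t u)) →
        ∃! M, DualPolarOrlicz.IsSolution φ μ (DualPolarOrlicz.tildeB H) M) := by
    rintro H hH ⟨c, T, hc, hcH⟩ hconv
    obtain ⟨M, hM⟩ := DualPolarOrlicz.exists_isSolution_tildeB hφ hμ hH hc hcH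
    exact ⟨⟨M, hM⟩, fun hφc hGc => ⟨M, hM, fun M' hM' =>
      DualPolarOrlicz.eq_of_isSolution_tildeB hφ hμ0 hH hφc (hconv hGc) hM' hM⟩⟩
  refine ⟨key G hG ⟨c, 1, hc, hcG⟩ id, ?_⟩
  obtain ⟨η, hη, hB⟩ := hG.exists_hatB_eq_tildeB
  rw [hB]
  -- The growth bound at `η * t` needs `η * t ≥ 1`, so the threshold moves from `1` to `η⁻¹`.
  refine key _ (hG.comp_mul hη) ⟨c * η ^ (n - 1), η⁻¹, by positivity, fun t ht u => ?_⟩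
    fun h u => DualPolarOrlicz.convexOn_comp_mul (h u) hη
  rw [mul_assoc, ← mul_pow]
  refine hcG _ ?_ u
  have := mul_le_mul_of_nonneg_left ht hη.le
  rwa [mul_inv_cancel₀ hη.ne'] at this
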